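/- Let $p$ be a prime number. For a scheme $X$ over $\mathbb{Z}_{(p)}$ (the localization of $\mathbb{Z}$ at the prime ideal $(p)$) let $\mathcal{O}_X^{\mathrm{perf}} := \varinjlim_{s \mapsto s^p} \mathcal{O}_X$ be the colimit of the sequence $\mathcal{O}_X \to \mathcal{O}_X \to \cdots$ whose transition maps all raise sections to the $p$-th power; explicitly, it is the sheaf of multiplicative monoids on $X$ which is the sheafification of the presheaf $U \mapsto \varinjlim_{s\mapsto s^p} \mathcal{O}_X(U)$. Let $X_{\mathbb{Q}} := X \times_{\operatorname{Spec}\mathbb{Z}} \operatorname{Spec}\mathbb{Q}$, with projection $i_X \colon X_{\mathbb{Q}} \to X$. **Lemma.** Let $f \colon X \to Y$ be a universal homeomorphism of schemes over $\mathbb{Z}_{(p)}$ (that is, every base change of $f$ is a homeomorphism on underlying topological spaces), and let $f_{\mathbb{Q}} \colon X_{\mathbb{Q}} \to Y_{\mathbb{Q}}$ be its base change. Then the square $$\begin{array}{ccc} \mathcal{O}_Y^{\mathrm{perf}} & \xrightarrow{\ f^*\ } & f_*\mathcal{O}_X^{\mathrm{perf}} \\ \downarrow & & \downarrow \\ (i_Y)_*\mathcal{O}_{Y_{\mathbb{Q}}}^{\mathrm{perf}}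 & \longrightarrow & (f\circ i_X)_*\mathcal{O}_{X_{\mathbb{Q}}}^{\mathrm{perf}} \end{array}$$ of sheaves of monoids on $Y$, whose maps are the pullbacks of sections along $f$, $i_Y$, $i_X$ and $f_{\mathbb{Q}}$ (note that $f\circ i_X = i_Y \circ f_{\mathbb{Q}}$), is Cartesian in the category of sheaves of monoids on $Y$. -/

import Mathlib

open CategoryTheory AlgebraicGeometry TopologicalSpace

universe u

noncomputable section

instance isPrime_span_natCast (p : ℕ) [hp : Fact p.Prime] :
    (Ideal.span {(p : ℤ)}).IsPrime :=
  (Ideal.span_singleton_prime (Int.natCast_ne_zero.mpr hp.out.ne_zero)).mpr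
    (Nat.prime_iff_prime_int.mp hp.out)

/-- `Spec ℤ_(p)`, where `ℤ_(p)` is the localization of `ℤ` at its prime ideal `(p)`
(lifted to the universe `u`). -/
abbrev SpecZLocalized (p : ℕ) [Fact p.Prime] : Scheme.{u} :=
  Spec (CommRingCat.of (ULift.{u} (Localization.AtPrime (Ideal.span {(p : ℤ)}))))

/-- A universal homeomorphism: every base change is a homeomorphism on underlying spaces. -/
def IsUniversalHomeomorphism {X Y : Scheme.{u}} (f : X ⟶ Y) : Prop :=
  MorphismProperty.universally (topologically (IsHomeomorph ·)) f

/-! ### The rational fibre `X_ℚ = X ×_{Spec ℤ} Spec ℚ` -/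

/-- `Spec ℚ`. -/
abbrev SpecRat : Scheme.{u} := Spec (CommRingCat.of (ULift.{u} ℚ))

/-- `X_ℚ`, the fibre product of the unique morphisms `X ⟶ Spec ℤ` and `Spec ℚ ⟶ Spec ℤ`. -/
def rationalFiber (X : Scheme.{u}) : Scheme.{u} :=
  Limits.pullback (specULiftZIsTerminal.from X) (specULiftZIsTerminal.from SpecRat.{u})

/-- The projection `X_ℚ ⟶ X`. -/
def rationalFiberι (X : Scheme.{u}) : rationalFiber X ⟶ X :=
  Limits.pullback.fst _ _

/-- The base change `f_ℚ : X_ℚ ⟶ Y_ℚ` of `f : X ⟶ Y`. -/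
def rationalFiberMap {X Y : Scheme.{u}} (f : X ⟶ Y) : rationalFiber X ⟶ rationalFiber Y :=
  Limits.pullback.map _ _ _ _ f (𝟙 _) (𝟙 _)
    (specULiftZIsTerminal.hom_ext _ _) (specULiftZIsTerminal.hom_ext _ _)

theorem rationalFiberMap_comp_ι {X Y : Scheme.{u}} (f : X ⟶ Y) :
    rationalFiberMap f ≫ rationalFiberι Y = rationalFiberι X ≫ f :=
  Limits.pullback.lift_fst _ _ _

/-! ### The multiplicative perfection of a commutative monoid -/

/-- The iterated transition map `x ↦ x ^ (p ^ (j - i))` from stage `i` to stage `j` of the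
sequence `A → A → A → ⋯` of `p`-th power maps. -/
def perfTransition (p : ℕ) (A : Type u) [CommMonoid A] (i j : ℕ) (_ : i ≤ j) : A →* A :=
  powMonoidHom (p ^ (j - i))

instance perfTransition_directedSystem (p : ℕ) (A : Type u) [CommMonoid A] :
    DirectedSystem (fun _ : ℕ ↦ A) (perfTransition p A · · ·) where
  map_self i x := by simp [perfTransition]
  map_map k j i hij hjk x := by
    simp only [perfTransition, powMonoidHom_apply, ← pow_mul, ← pow_add]
    congr 2
    omega

/-- `A^perf`, the direct limit of `A → A → A → ⋯` along `x ↦ x ^ p`. -/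
abbrev MulPerf (p : ℕ) (A : Type u) [CommMonoid A] : Type u :=
  DirectLimit (fun _ : ℕ ↦ A) (perfTransition p A)

/-- The monoid homomorphism `A^perf → B^perf` induced by `φ : A → B`, stage by stage. -/
def MulPerf.map (p : ℕ) {A B : Type u} [CommMonoid A] [CommMonoid B] (φ : A →* B) :
    MulPerf p A →* MulPerf p B where
  toFun := DirectLimit.map _ _ (fun _ ↦ φ) (fun i j h x ↦ by simp [perfTransition])
  map_one' := by
    rw [DirectLimit.one_def 0, DirectLimit.one_def 0, DirectLimit.map_def, map_one]
  map_mul' x y := by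
    obtain ⟨i, a, b, rfl, rfl⟩ := DirectLimit.exists_eq_mk₂ _ x y
    simp only [DirectLimit.mul_def, DirectLimit.map_def, map_mul]

/-- Multiplicative perfection, as a functor from commutative rings to monoids. -/
def mulPerfFunctor (p : ℕ) : CommRingCat.{u} ⥤ MonCat.{u} where
  obj A := MonCat.of (MulPerf p A)
  map φ := MonCat.ofHom (MulPerf.map p (φ.hom : _ →* _))
  map_id A := by
    ext x
    obtain ⟨i, a, rfl⟩ := DirectLimit.exists_eq_mk _ x
    rfl
  map_comp φ ψ := by
    ext x
    obtain ⟨i, a, rfl⟩ := DirectLimit.exists_eq_mk _ x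
    rfl

/-! ### The sheaf `𝒪_X^perf` and its functoriality -/

/-- The presheaf of monoids `U ↦ 𝒪_X(U)^perf`. -/
def perfPresheaf (p : ℕ) (X : Scheme.{u}) : TopCat.Presheaf MonCat.{u} X :=
  X.presheaf ⋙ mulPerfFunctor p

/-- The sheaf of monoids `𝒪_X^perf`: the sheafification of `U ↦ 𝒪_X(U)^perf`. -/
def perfSheaf (p : ℕ) (X : Scheme.{u}) : TopCat.Sheaf MonCat.{u} X :=
  (presheafToSheaf (Opens.grothendieckTopology X) MonCat.{u}).obj (perfPresheaf p X)

/-- The canonical map from `U ↦ 𝒪_X(U)^perf` to its sheafification. -/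
def toPerfSheaf (p : ℕ) (X : Scheme.{u}) : perfPresheaf p X ⟶ (perfSheaf p X).obj :=
  toSheafify (Opens.grothendieckTopology X) (perfPresheaf p X)

/-- The map `𝒪_Y(U)^perf → 𝒪_X(f⁻¹U)^perf` of presheaves on `Y`. -/
def perfPresheafPullback (p : ℕ) {X Y : Scheme.{u}} (f : X ⟶ Y) :
    perfPresheaf p Y ⟶ (TopCat.Presheaf.pushforward MonCat.{u} f.base).obj (perfPresheaf p X) :=
  Functor.whiskerRight f.c (mulPerfFunctor p)

/-- The map `f^* : 𝒪_Y^perf ⟶ f_* 𝒪_X^perf` of sheaves on `Y`, induced by `f : X ⟶ Y` through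
the universal property of sheafification. -/
def perfPullback (p : ℕ) {X Y : Scheme.{u}} (f : X ⟶ Y) :
    perfSheaf p Y ⟶ (TopCat.Sheaf.pushforward MonCat.{u} f.base).obj (perfSheaf p X) :=
  ⟨sheafifyLift (Opens.grothendieckTopology Y)
    (perfPresheafPullback p f ≫
      (TopCat.Presheaf.pushforward MonCat.{u} f.base).map (toPerfSheaf p X))
    ((TopCat.Sheaf.pushforward MonCat.{u} f.base).obj (perfSheaf p X)).property⟩

/-- For a commutative triangle `g ≫ f = h` of morphisms `g : W ⟶ X`, `f : X ⟶ Y`, `h : W ⟶ Y`,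
the map `f_* 𝒪_X^perf ⟶ f_* g_* 𝒪_W^perf = h_* 𝒪_W^perf` of sheaves on `Y`, the direct image
of `g^*`. -/
def perfPullbackOver (p : ℕ) {W X Y : Scheme.{u}} (g : W ⟶ X) (f : X ⟶ Y) (h : W ⟶ Y)
    (w : g ≫ f = h) :
    (TopCat.Sheaf.pushforward MonCat.{u} f.base).obj (perfSheaf p X) ⟶
      (TopCat.Sheaf.pushforward MonCat.{u} h.base).obj (perfSheaf p W) :=
  (TopCat.Sheaf.pushforward MonCat.{u} f.base).map (perfPullback p g) ≫
    ⟨(TopCat.Presheaf.pushforwardEq (congrArg (fun k : W ⟶ Y ↦ k.base) w) (perfSheaf p W).obj).hom⟩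

end

/-! The square can be tested on affine opens $V$ of $Y$. A universal homeomorphism is integral and
the projections from the rational fibres are affine, so all four preimages of $V$ are affine, and
there the sections of the perfection sheaf are the perfection of the ring of sections. As integers
prime to $p$ are units, passing to the rational fibre inverts $p$. What remains concerns a ring map
$A \to B$ and its localization $A[1/p] \to B[1/p]$, where $A \to B$ is integral with nil kernel
(surjectivity of $f$) and every $b \otimes 1 - 1 \otimes b$ in $B \otimes_A B$ is nilpotent
(universal injectivity).

Uniqueness (`exists_pow_eq_pow_of_map_eq`): two elements of $A$ with equal images in $B$ and
$A[1/p]$ differ by a nilpotent $d$ killed by a power of $p$. Low binomial coefficients of $p^M$ are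
highly divisible by $p$, so $d$ disappears from a high $p$-power power.

Existence (`exists_map_eq_pow_of_map_eq`): if $b$ and $a'$ agree in $B[1/p]$, some $p^n b$ comes
from $A$. Modulo $p$ the extension is $p$-radicial, so $b^{p^N} = a + pc$; as $p^k\binom{p^M}{k}$ is
divisible by $p^M$, a further $p^M$-th power comes from $A$. The error left in $A[1/p]$ is a
nilpotent element of $A$ divided by a power of $p$, and is absorbed by another binomial expansion.

The characteristic $p$ step is `algebraMap_surjective_of_forall_pow_tmul`: a conductor argument at a
minimal prime, with descent over its residue field. -/

/-! ### Radicial integral extensions in characteristic $p$ -/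

open TensorProduct in
/-- An element of an algebra over a field that has the same image under both coprojections to the
tensor square lies in the field. -/
theorem mem_range_algebraMap_of_tmul_one_eq_one_tmul {K B : Type*} [Field K] [CommRing B]
    [Algebra K B] {c : B} (hc : c ⊗ₜ[K] (1 : B) = 1 ⊗ₜ[K] c) : c ∈ (algebraMap K B).range := by
  nontriviality B
  let N : Submodule K B := LinearMap.range (Algebra.linearMap K B)
  -- Tensoring with the quotient map $B \to B/K$ kills $c \otimes 1$; a nonzero $K$-vector space is
  -- faithfully flat, so the class of $c$ in $B/K$ vanishes.
  have h1 : (1 : B) ⊗ₜ[K] N.mkQ c = 0 := by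
    have h := congrArg (LinearMap.lTensor B N.mkQ) hc
    rw [LinearMap.lTensor_tmul, LinearMap.lTensor_tmul] at h
    rw [← h, show N.mkQ (1 : B) = 0 from
      (Submodule.Quotient.mk_eq_zero N).2 ⟨1, by simp⟩, TensorProduct.tmul_zero]
  rw [Module.FaithfullyFlat.one_tmul_eq_zero_iff, Submodule.mkQ_apply,
    Submodule.Quotient.mk_eq_zero] at h1
  obtain ⟨k, hk⟩ := h1
  exact ⟨k, hk⟩

open TensorProduct in
/-- If `c` has the same image under both coprojections `B → B ⊗[S] B`, then for every prime `q` of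
`S` some multiple of `c` by an element outside `q` is congruent to an element of `S` modulo
every prime of `B` over `q`. -/
theorem exists_smul_sub_mem_of_tmul_one_eq_one_tmul {S B : Type*} [CommRing S] [CommRing B]
    [Algebra S B] (q : Ideal S) [q.IsPrime] {c : B} (hc : c ⊗ₜ[S] (1 : B) = 1 ⊗ₜ[S] c) :
    ∃ s ∉ q, ∃ a : S, ∀ Q : Ideal B, Q.IsPrime → q = Q.comap (algebraMap S B) →
      algebraMap S B s * c - algebraMap S B a ∈ Q := by
  let K := q.ResidueField
  let BK := K ⊗[S] B
  let j : B →ₐ[S] BK := Algebra.TensorProduct.includeRight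
  let F : B ⊗[S] B →ₐ[S] BK ⊗[K] BK := Algebra.TensorProduct.lift
    ((Algebra.TensorProduct.includeLeft (R := K) (S := K) (A := BK) (B := BK)).restrictScalars S
      |>.comp j)
    ((Algebra.TensorProduct.includeRight (R := K) (A := BK) (B := BK)).restrictScalars S
      |>.comp j) (fun _ _ ↦ Commute.all _ _)
  have hF : j c ⊗ₜ[K] (1 : BK) = 1 ⊗ₜ[K] j c := by
    have h := congrArg F hc
    simpa [F] using h
  obtain ⟨k, hk⟩ := mem_range_algebraMap_of_tmul_one_eq_one_tmul hF
  -- Over the residue field of `q` the element `c` becomes a constant `k`, a fraction over `S ⧸ q`;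
  -- `a` and `s` lift its numerator and denominator.
  obtain ⟨x, y, hy, hxy⟩ := IsFractionRing.div_surjective (A := S ⧸ q) k
  obtain ⟨a, rfl⟩ := Ideal.Quotient.mk_surjective x
  obtain ⟨s, rfl⟩ := Ideal.Quotient.mk_surjective y
  have hs : s ∉ q := fun h ↦ nonZeroDivisors.ne_zero hy (Ideal.Quotient.eq_zero_iff_mem.2 h)
  have hs' : algebraMap S K s ≠ 0 := fun h ↦ hs (Ideal.algebraMap_residueField_eq_zero.1 h)
  have hk' : algebraMap S K s * k = algebraMap S K a := by
    rw [← hxy]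
    change algebraMap S K s * (algebraMap S K a / algebraMap S K s) = _
    rw [mul_comm, div_mul_cancel₀ _ hs']
  refine ⟨s, hs, a, fun Q hQ hqQ ↦ ?_⟩
  let G : BK →ₐ[S] Q.ResidueField := Algebra.TensorProduct.lift
    (Ideal.ResidueField.mapₐ q Q (Algebra.ofId S B) hqQ) (IsScalarTower.toAlgHom S B _)
    (fun _ _ ↦ Commute.all _ _)
  have hGj : ∀ b, G (j b) = algebraMap B Q.ResidueField b := fun b ↦
    (Algebra.TensorProduct.lift_tmul _ _ _ _ _).trans (by rw [map_one, one_mul]; rfl)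
  have key : j (algebraMap S B s * c - algebraMap S B a) = 0 := by
    have h1 : ∀ r : S, j (algebraMap S B r) = algebraMap K BK (algebraMap S K r) := fun r ↦ by
      rw [AlgHom.commutes, ← IsScalarTower.algebraMap_apply]
    rw [map_sub, map_mul, h1, h1, ← hk, ← map_mul, hk', sub_self]
  rw [← Ideal.algebraMap_residueField_eq_zero, ← hGj, key, map_zero]

/-- Let `q` be a minimal prime over the trace on `S` of an ideal `J` of `T`, and let `T ⊆ B` be
integral. An element of `T` lying in all primes of `B` over `q` is, up to elements outside `q`,
nilpotent modulo `J`. -/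
theorem exists_mul_pow_mem_of_mem_minimalPrimes {S T B : Type*} [CommRing S] [CommRing T]
    [CommRing B] [Algebra S T] [Algebra T B] [Algebra S B] [IsScalarTower S T B]
    [Algebra.IsIntegral T B] (J : Ideal T) {q : Ideal S}
    (hq : q ∈ (J.comap (algebraMap S T)).minimalPrimes)
    (hinj : Function.Injective (algebraMap T B)) {e : T}
    (he : ∀ Q : Ideal B, Q.IsPrime → q = Q.comap (algebraMap S B) → algebraMap T B e ∈ Q) :
    ∃ t ∉ q, ∃ m : ℕ, algebraMap S T t * e ^ m ∈ J := by
  have hqp : q.IsPrime := hq.1.1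
  by_contra! hcon
  -- A prime $P \supseteq J$ avoiding `M` would lie over `q` by minimality of `q`; a prime of `B`
  -- over $P$ then forces $e \in P$, although `e` is in `M`.
  let M : Submonoid T := (q.primeCompl.map (algebraMap S T)) ⊔ Submonoid.powers e
  have hdisj : Disjoint (J : Set T) M := by
    rw [Set.disjoint_left]
    rintro x hxJ hxM
    obtain ⟨_, ⟨t, ht, rfl⟩, _, ⟨m, rfl⟩, rfl⟩ := Submonoid.mem_sup.1 hxM
    exact hcon t ht m hxJ
  obtain ⟨P, hP, hJP, hPM⟩ := Ideal.exists_le_prime_disjoint J M hdisj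
  have hPq : P.comap (algebraMap S T) ≤ q := fun x hx ↦ by
    by_contra hxq
    exact Set.disjoint_left.1 hPM hx (Submonoid.mem_sup_left (Submonoid.mem_map_of_mem _ hxq))
  have hqP : q = P.comap (algebraMap S T) :=
    le_antisymm (hq.2 ⟨inferInstance, Ideal.comap_mono hJP⟩ hPq) hPq
  obtain ⟨Q, -, hQ, hQP⟩ := Ideal.exists_ideal_over_prime_of_isIntegral (S := B) P ⊥ (by
    intro x hx
    rw [hinj (hx.trans (map_zero _).symm)]
    exact P.zero_mem)
  have heP : e ∈ P := by
    rw [← hQP]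
    exact he Q hQ (by rw [hqP, ← hQP, Ideal.comap_comap, ← IsScalarTower.algebraMap_eq])
  exact Set.disjoint_left.1 hPM heP (Submonoid.mem_sup_right (Submonoid.mem_powers e))

theorem CharP.of_prime_cast_eq_zero {p : ℕ} [hp : Fact p.Prime] {R : Type*} [CommRing R]
    [Nontrivial R] (h : (p : R) = 0) : CharP R p :=
  ringChar.of_eq (CharP.ringChar_of_prime_eq_zero hp.out h)

open TensorProduct in
/-- Let `S → T → B` with `T → B` injective, `T` finite over `S` and `B` integral over `S`. If the
image of `S` in `T` is closed under `p`-power roots, and if elements of `T` satisfy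
`y ⊗ 1 = 1 ⊗ y` in `B ⊗[S] B` up to `p`-powers, then `S → T` is surjective. -/
theorem algebraMap_surjective_of_forall_pow_tmul {p : ℕ} [Fact p.Prime] {S T B : Type*}
    [CommRing S] [CommRing T] [CommRing B] [Algebra S T] [Algebra T B] [Algebra S B]
    [IsScalarTower S T B] [Module.Finite S T] [Algebra.IsIntegral T B]
    (hinj : Function.Injective (algebraMap T B))
    (hS : ∀ n (x : T), x ^ p ^ n ∈ (algebraMap S T).range → x ∈ (algebraMap S T).range)
    (h : ∀ y : T, ∃ n, (algebraMap T B (y ^ p ^ n)) ⊗ₜ[S] (1 : B) =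
      1 ⊗ₜ[S] (algebraMap T B (y ^ p ^ n))) :
    Function.Surjective (algebraMap S T) := by
  have hp1 : 1 < p := (Fact.out : p.Prime).one_lt
  let R : Subring T := (algebraMap S T).range
  -- The conductor: the largest ideal of `T` contained in the image `R` of `S`. It is radical
  -- because `R` is closed under $p$-power roots.
  let J : Ideal T :=
    { carrier := {x | ∀ y : T, x * y ∈ R}
      add_mem' := fun {x x'} hx hx' y ↦ by
        rw [add_mul]; exact R.add_mem (hx y) (hx' y)
      zero_mem' := fun y ↦ by rw [zero_mul]; exact R.zero_mem
      smul_mem' := fun r x hx y ↦ by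
        rw [smul_eq_mul, mul_comm r x, mul_assoc]; exact hx _ }
  have hJ_def : ∀ x, x ∈ J ↔ ∀ y : T, x * y ∈ R := fun _ ↦ Iff.rfl
  have hJrad : ∀ (x : T) (m : ℕ), x ^ m ∈ J → x ∈ J := fun x m hx y ↦ by
    refine hS m _ ?_
    have h1 : x ^ p ^ m ∈ J := J.pow_mem_of_pow_mem hx (Nat.lt_pow_self hp1).le
    rw [mul_pow]
    exact h1 (y ^ p ^ m)
  clear_value J
  by_cases hJ : J.comap (algebraMap S T) = ⊤
  · intro b
    have h1 : (1 : T) ∈ J := (Ideal.eq_top_iff_one J).1 (by simpa using hJ)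
    have := (hJ_def 1).1 h1 b
    rwa [one_mul] at this
  exfalso
  obtain ⟨q, hq⟩ := Ideal.nonempty_minimalPrimes hJ
  have hqp : q.IsPrime := hq.1.1
  have hR : ∀ s : S, algebraMap S T s ∈ R := fun s ↦ ⟨s, rfl⟩
  have key : ∀ y : T, ∃ u : S, u ∉ q ∧ algebraMap S T u * y ∈ R := by
    intro y
    obtain ⟨N, hN⟩ := h y
    obtain ⟨s, hs, a, hsa⟩ := exists_smul_sub_mem_of_tmul_one_eq_one_tmul q hN
    let e : T := algebraMap S T s * y ^ p ^ N - algebraMap S T a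
    obtain ⟨t, ht, m, htm⟩ := exists_mul_pow_mem_of_mem_minimalPrimes (e := e) J hq hinj
      (fun Q hQ hqQ ↦ by
        have := hsa Q hQ hqQ
        rwa [IsScalarTower.algebraMap_apply S T B, IsScalarTower.algebraMap_apply S T B,
          ← map_mul, ← map_sub] at this)
    have hte : algebraMap S T t * e ∈ J := by
      refine hJrad _ (m + 1) ?_
      rw [show ∀ x z : T, (x * z) ^ (m + 1) = x ^ m * z * (x * z ^ m) by intros; ring]
      exact J.mul_mem_left (algebraMap S T t ^ m * e) htm
    have hte' := (hJ_def _).1 hte 1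
    rw [mul_one] at hte'
    refine ⟨t * s, fun hts ↦ (hqp.mem_or_mem hts).elim ht hs, hS N _ ?_⟩
    have h3 : algebraMap S T t * algebraMap S T s * y ^ p ^ N ∈ R := by
      have := R.add_mem hte' (R.mul_mem (hR t) (hR a))
      rwa [← mul_add, sub_add_cancel, ← mul_assoc] at this
    -- Multiplying by $(ts)^{p^N-1}$ completes the $p^N$-th power of $tsy$, whose root then lies in
    -- `R`.
    have h4 := R.mul_mem (R.pow_mem (hR (t * s)) (p ^ N - 1)) h3
    have h5 : p ^ N - 1 + 1 = p ^ N := Nat.sub_add_cancel (Nat.one_le_pow _ _ (by omega))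
    rwa [← map_mul, ← mul_assoc, ← pow_succ, h5, ← mul_pow] at h4
  let W : Submodule S T := LinearMap.range (Algebra.linearMap S T)
  -- By `key`, $T/R$ vanishes at `q`. Being finite, it is killed by a single $u \notin q$; but then
  -- $u$ lies in the conductor, hence in `q`.
  have hsupp : (⟨q, hqp⟩ : PrimeSpectrum S) ∉ Module.support S (T ⧸ W) := by
    rw [Module.notMem_support_iff']
    intro m
    obtain ⟨y, rfl⟩ := W.mkQ_surjective m
    obtain ⟨u, hu, z, hz⟩ := key y
    refine ⟨u, hu, ?_⟩
    rw [← map_smul, Submodule.mkQ_apply, Submodule.Quotient.mk_eq_zero, Algebra.smul_def]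
    exact ⟨z, hz⟩
  rw [Module.mem_support_iff_of_finite, SetLike.le_def] at hsupp
  push Not at hsupp
  obtain ⟨u, hu, huq⟩ := hsupp
  refine huq (hq.1.2 ((hJ_def _).2 fun y ↦ ?_))
  rw [Module.mem_annihilator] at hu
  have := hu (W.mkQ y)
  rw [← map_smul, Submodule.mkQ_apply, Submodule.Quotient.mk_eq_zero, Algebra.smul_def] at this
  obtain ⟨z, hz⟩ := this
  exact ⟨z, hz⟩

open TensorProduct in
/-- Over a subalgebra `S` closed under `p`-power roots, an integral algebra `B` in which
`b ⊗ 1 = 1 ⊗ b` holds up to `p`-powers equals `S`. -/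
theorem Subalgebra.eq_top_of_forall_pow_mem {p : ℕ} [Fact p.Prime] {A B : Type*} [CommRing A]
    [CommRing B] [Algebra A B] [Algebra.IsIntegral A B] (S : Subalgebra A B)
    (hS : ∀ n x, x ^ p ^ n ∈ S → x ∈ S)
    (h : ∀ b : B, ∃ n, (b ^ p ^ n) ⊗ₜ[S] (1 : B) = 1 ⊗ₜ[S] (b ^ p ^ n)) : S = ⊤ := by
  have : Algebra.IsIntegral S B := .tower_top A
  refine eq_top_iff.2 fun b _ ↦ ?_
  have hSfin : Module.Finite S (Algebra.adjoin S {b}) :=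
    Algebra.finite_adjoin_simple_of_isIntegral (Algebra.IsIntegral.isIntegral b)
  have hTB : Algebra.IsIntegral (Algebra.adjoin S {b}) B := .tower_top S
  obtain ⟨s, hs⟩ := algebraMap_surjective_of_forall_pow_tmul (p := p) (S := S)
    (T := Algebra.adjoin S {b}) (B := B) Subtype.val_injective (fun n x ⟨s, hs⟩ ↦
      ⟨⟨x, hS n x (by
        have := congrArg Subtype.val hs
        rw [Subalgebra.coe_pow] at this
        rw [← this]
        exact s.2)⟩, Subtype.ext rfl⟩)
    (fun y ↦ h y) ⟨b, Algebra.self_mem_adjoin_singleton S b⟩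
  have : (s : B) = b := congrArg Subtype.val hs
  rw [← this]
  exact s.2

open TensorProduct in
/-- An integral algebra of characteristic `p` such that all `b ⊗ 1 - 1 ⊗ b` are nilpotent is
`p`-radicial. -/
theorem exists_pow_mem_range_of_isNilpotent_tmul_sub_charP {p : ℕ} [Fact p.Prime] {A B : Type*}
    [CommRing A] [CommRing B] [Algebra A B] [CharP B p] [Algebra.IsIntegral A B]
    (h : ∀ b : B, IsNilpotent (b ⊗ₜ[A] (1 : B) - 1 ⊗ₜ[A] b)) (b : B) :
    ∃ n, b ^ p ^ n ∈ (algebraMap A B).range := by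
  have hp1 : 1 < p := (Fact.out : p.Prime).one_lt
  let S : Subalgebra A B :=
    { carrier := {x | ∃ n, x ^ p ^ n ∈ (algebraMap A B).range}
      mul_mem' := by
        rintro x y ⟨n, hn⟩ ⟨m, hm⟩
        refine ⟨n + m, ?_⟩
        rw [mul_pow, pow_add, pow_mul, mul_comm (p ^ n), pow_mul y]
        exact mul_mem (pow_mem hn _) (pow_mem hm _)
      add_mem' := by
        rintro x y ⟨n, hn⟩ ⟨m, hm⟩
        refine ⟨n + m, ?_⟩
        rw [add_pow_char_pow, pow_add, pow_mul, mul_comm (p ^ n), pow_mul y]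
        exact add_mem (pow_mem hn _) (pow_mem hm _)
      algebraMap_mem' := fun r ↦ ⟨0, by simp⟩ }
  have hS : S = ⊤ := by
    refine S.eq_top_of_forall_pow_mem (p := p) ?_ fun x ↦ ?_
    · rintro n x ⟨m, hm⟩
      exact ⟨n + m, by rwa [pow_add, pow_mul]⟩
    · let π : B ⊗[A] B →ₐ[A] B ⊗[S] B := Algebra.TensorProduct.lift
        ((Algebra.TensorProduct.includeLeft (R := S) (S := S) (A := B) (B := B)).restrictScalars A)
        ((Algebra.TensorProduct.includeRight (R := S) (A := B) (B := B)).restrictScalars A)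
        (fun _ _ ↦ Commute.all _ _)
      obtain ⟨m, hm⟩ := (h x).map π
      rcases subsingleton_or_nontrivial (B ⊗[S] B) with hs | hs
      · exact ⟨0, Subsingleton.elim _ _⟩
      have : CharP (B ⊗[S] B) p := CharP.of_prime_cast_eq_zero <| by
        rw [← map_natCast (algebraMap B (B ⊗[S] B)), CharP.cast_eq_zero, map_zero]
      refine ⟨m, ?_⟩
      -- As $m < p^m$ and Frobenius is additive on $B \otimes_S B$, nilpotence becomes equality of
      -- the $p^m$-th powers of $x \otimes 1$ and $1 \otimes x$.
      have h1 := pow_eq_zero_of_le (Nat.lt_pow_self (n := m) hp1).le hm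
      have h2 : π (x ⊗ₜ[A] (1 : B) - 1 ⊗ₜ[A] x) = x ⊗ₜ[S] (1 : B) - 1 ⊗ₜ[S] x := by
        simp [π]
      rw [h2, sub_pow_char_pow, sub_eq_zero, Algebra.TensorProduct.tmul_pow,
        Algebra.TensorProduct.tmul_pow, one_pow] at h1
      exact h1
  have : b ∈ S := hS ▸ Algebra.mem_top
  exact this

/-! ### From characteristic $p$ to elements with a $p$-multiple in $A$ -/

/-- `p ^ M` divides `p ^ k * (p ^ M).choose k` for `k ≠ 0`. -/
theorem Nat.Prime.pow_dvd_pow_mul_choose {p : ℕ} (hp : p.Prime) (M : ℕ) {k : ℕ} (hk0 : k ≠ 0) :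
    p ^ M ∣ p ^ k * (p ^ M).choose k := by
  rcases Nat.lt_or_ge (p ^ M) k with hk | hk
  · simp [Nat.choose_eq_zero_of_lt hk]
  rw [hp.pow_dvd_iff_le_factorization
    (mul_ne_zero (pow_ne_zero _ hp.ne_zero) (Nat.choose_pos hk).ne'),
    Nat.factorization_mul (pow_ne_zero _ hp.ne_zero) (Nat.choose_pos hk).ne', Finsupp.add_apply,
    Nat.factorization_choose_prime_pow hp hk hk0, hp.factorization_pow, Finsupp.single_eq_same]
  -- The valuation of $\binom{p^M}{k}$ is $M - v_p(k)$, so $v_p(k) < k$ suffices.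
  have : k.factorization p < k := Nat.factorization_lt p hk0
  omega

open TensorProduct in
-- The hypotheses pass to $B/pB$, where the characteristic $p$ result applies unless the quotient is
-- zero; in that case `b` is itself a multiple of $p$.
theorem exists_pow_sub_mem_range_of_isNilpotent_tmul_sub {p : ℕ} [Fact p.Prime] {A B : Type*}
    [CommRing A] [CommRing B] [Algebra A B] [Algebra.IsIntegral A B]
    (h : ∀ b : B, IsNilpotent (b ⊗ₜ[A] (1 : B) - 1 ⊗ₜ[A] b)) (b : B) :
    ∃ (n : ℕ) (a : A) (c : B), b ^ p ^ n = algebraMap A B a + p * c := by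
  let I : Ideal B := Ideal.span {(p : B)}
  have hI : ∀ x y : B, Ideal.Quotient.mk I x = Ideal.Quotient.mk I y → ∃ c, x = y + p * c := by
    intro x y hxy
    obtain ⟨c, hc⟩ := Ideal.mem_span_singleton.1 (Ideal.Quotient.eq.1 hxy)
    exact ⟨c, by rw [← hc]; ring⟩
  rcases subsingleton_or_nontrivial (B ⧸ I) with hs | hs
  · obtain ⟨c, hc⟩ := hI b 0 (Subsingleton.elim _ _)
    exact ⟨0, 0, c, by simpa using hc⟩
  have : CharP (B ⧸ I) p := CharP.of_prime_cast_eq_zero <| by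
    rw [← map_natCast (Ideal.Quotient.mk I), Ideal.Quotient.eq_zero_iff_mem]
    exact Ideal.mem_span_singleton_self _
  have : Algebra.IsIntegral A (B ⧸ I) := .trans B
  have hnil : ∀ x : B ⧸ I, IsNilpotent (x ⊗ₜ[A] (1 : B ⧸ I) - 1 ⊗ₜ[A] x) := fun x ↦ by
    obtain ⟨y, rfl⟩ := Ideal.Quotient.mk_surjective x
    have := (h y).map (Algebra.TensorProduct.map (Ideal.Quotient.mkₐ A I) (Ideal.Quotient.mkₐ A I))
    simpa using this
  obtain ⟨n, a, ha⟩ := exists_pow_mem_range_of_isNilpotent_tmul_sub_charP (p := p) hnil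
    (Ideal.Quotient.mk I b)
  obtain ⟨c, hc⟩ := hI (b ^ p ^ n) (algebraMap A B a) (by rw [map_pow, ← ha]; rfl)
  exact ⟨n, a, c, hc⟩

/-- Elements of `B` that some power of `p` moves into the image of `A`. -/
def Subalgebra.powMulMemRange (p : ℕ) (A B : Type*) [CommRing A] [CommRing B] [Algebra A B] :
    Subalgebra A B where
  carrier := {x | ∃ k : ℕ, (p : B) ^ k * x ∈ (algebraMap A B).range}
  mul_mem' := by
    rintro x y ⟨n, hn⟩ ⟨m, hm⟩
    refine ⟨n + m, ?_⟩
    rw [pow_add, mul_mul_mul_comm]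
    exact mul_mem hn hm
  add_mem' := by
    rintro x y ⟨n, hn⟩ ⟨m, hm⟩
    refine ⟨n + m, ?_⟩
    rw [mul_add, pow_add, mul_right_comm, mul_assoc _ _ y, mul_comm]
    exact add_mem (mul_mem (pow_mem (natCast_mem _ _) _) hn)
      (mul_mem (pow_mem (natCast_mem _ _) _) hm)
  algebraMap_mem' r := ⟨0, r, by simp⟩

theorem Submodule.FG.exists_pow_mul_mem_range {p : ℕ} {A B : Type*} [CommRing A] [CommRing B]
    [Algebra A B] {M : Submodule A B} (hM : M.FG)
    (h : ∀ x ∈ M, ∃ k : ℕ, (p : B) ^ k * x ∈ (algebraMap A B).range) :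
    ∃ k : ℕ, ∀ x ∈ M, (p : B) ^ k * x ∈ (algebraMap A B).range := by
  obtain ⟨s, rfl⟩ := hM
  have h' : ∀ x : B, ∃ k : ℕ, x ∈ s → (p : B) ^ k * x ∈ (algebraMap A B).range := fun x ↦ by
    by_cases hx : x ∈ s
    · obtain ⟨k, hk⟩ := h x (Submodule.subset_span hx)
      exact ⟨k, fun _ ↦ hk⟩
    · exact ⟨0, fun h ↦ absurd h hx⟩
  choose k hk using h'
  -- The sum serves as a common upper bound of the exponents of the generators.
  refine ⟨∑ x ∈ s, k x, fun x hx ↦ ?_⟩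
  induction hx using Submodule.span_induction with
  | mem x hx =>
    rw [← Nat.sub_add_cancel (Finset.single_le_sum (fun i _ ↦ Nat.zero_le (k i)) hx), pow_add,
      mul_assoc]
    exact mul_mem (pow_mem (natCast_mem _ _) _) (hk x hx)
  | zero => rw [mul_zero]; exact zero_mem _
  | add x y _ _ hx hy => rw [mul_add]; exact add_mem hx hy
  | smul a x _ hx => rw [mul_smul_comm, Algebra.smul_def]; exact mul_mem ⟨a, rfl⟩ hx

open TensorProduct in
/-- Let `B` be integral over `A` with all `b ⊗ 1 - 1 ⊗ b` nilpotent. If some `p ^ n * b` comes from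
`A`, then so does some `b ^ p ^ m`. -/
theorem exists_pow_mem_range_of_isNilpotent_tmul_sub {p : ℕ} [Fact p.Prime] {A B : Type*}
    [CommRing A] [CommRing B] [Algebra A B] [Algebra.IsIntegral A B]
    (h : ∀ b : B, IsNilpotent (b ⊗ₜ[A] (1 : B) - 1 ⊗ₜ[A] b)) {b : B} {n : ℕ}
    (hb : (p : B) ^ n * b ∈ (algebraMap A B).range) :
    ∃ m, b ^ p ^ m ∈ (algebraMap A B).range := by
  obtain ⟨N, a, c, hc⟩ := exists_pow_sub_mem_range_of_isNilpotent_tmul_sub (p := p) h b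
  let L := Subalgebra.powMulMemRange p A B
  have hbL : b ∈ L := ⟨n, hb⟩
  have hcL : c ∈ L := by
    have h1 : (p : B) * c ∈ L := by
      rw [eq_sub_iff_add_eq'.2 hc.symm]
      exact L.sub_mem (L.pow_mem hbL _) (L.algebraMap_mem a)
    obtain ⟨k, hk⟩ := h1
    exact ⟨k + 1, by rwa [pow_succ, mul_assoc]⟩
  -- By integrality $A[c]$ is a finite $A$-module, so one exponent `M` moves all powers of `c` into
  -- the image of `A`.
  obtain ⟨M, hM⟩ := (IsIntegral.fg_adjoin_singleton
    (Algebra.IsIntegral.isIntegral (R := A) c)).exists_pow_mul_mem_range (p := p)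
    fun x hx ↦ (Algebra.adjoin_le (Set.singleton_subset_iff.2 hcL) hx : x ∈ L)
  refine ⟨N + M, ?_⟩
  rw [pow_add, pow_mul, hc, add_comm, add_pow]
  refine sum_mem fun k _ ↦ ?_
  have ha : ∀ j : ℕ, algebraMap A B a ^ j ∈ (algebraMap A B).range := fun j ↦
    pow_mem (RingHom.mem_range_self _ a) j
  rcases eq_or_ne k 0 with rfl | hk0
  · simpa using ha (p ^ M)
  obtain ⟨w, hw⟩ := (Fact.out : p.Prime).pow_dvd_pow_mul_choose M hk0
  have hw' : (p : B) ^ k * ((p ^ M).choose k : B) = p ^ M * w := by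
    simpa using congrArg (Nat.cast : ℕ → B) hw
  have hck := hM (c ^ k) (pow_mem (Algebra.self_mem_adjoin_singleton A c) k)
  have : (p * c : B) ^ k * algebraMap A B a ^ (p ^ M - k) * ((p ^ M).choose k : B) =
      (p ^ M * c ^ k) * (w * algebraMap A B a ^ (p ^ M - k)) := by
    calc _ = ((p : B) ^ k * ((p ^ M).choose k : B)) * c ^ k * algebraMap A B a ^ (p ^ M - k) := by
          ring
      _ = _ := by rw [hw']; ring
  rw [this]
  exact mul_mem hck (mul_mem (natCast_mem _ _) (ha _))

/-! ### The square of rings -/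

theorem Nat.Prime.pow_dvd_choose {p : ℕ} (hp : p.Prime) {M k j : ℕ} (hk0 : k ≠ 0)
    (h : j + k ≤ M) : p ^ j ∣ (p ^ M).choose k := by
  have h1 : p ^ k * p ^ j ∣ p ^ k * (p ^ M).choose k := by
    rw [← pow_add]
    exact (pow_dvd_pow p (by omega)).trans (hp.pow_dvd_pow_mul_choose M hk0)
  exact Nat.dvd_of_mul_dvd_mul_left (pow_pos hp.pos k) h1

/-- Adding a nilpotent `p`-power torsion element does not change high `p`-power powers. -/
theorem exists_add_pow_eq_pow_of_isNilpotent {p : ℕ} [Fact p.Prime] {A : Type*} [CommRing A]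
    (a : A) {d : A} (hd : IsNilpotent d) {k : ℕ} (hk : (p : A) ^ k * d = 0) :
    ∃ M, (a + d) ^ p ^ M = a ^ p ^ M := by
  obtain ⟨m, hm⟩ := hd
  -- For $j \ge m$ the power $d^j$ vanishes; for $0 < j < m$ the binomial coefficient is divisible
  -- by $p^k$, which kills `d`.
  refine ⟨k + m, ?_⟩
  rw [add_comm, add_pow, Finset.sum_eq_single 0]
  · simp
  · intro j _ hj0
    rcases le_or_gt m j with hj | hj
    · rw [pow_eq_zero_of_le hj hm, zero_mul, zero_mul]
    obtain ⟨w, hw⟩ := (Fact.out : p.Prime).pow_dvd_choose (M := k + m) (j := k) hj0 (by omega)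
    obtain ⟨i, rfl⟩ := Nat.exists_eq_succ_of_ne_zero hj0
    rw [hw, Nat.cast_mul, Nat.cast_pow, Nat.succ_eq_add_one, pow_succ]
    linear_combination d ^ i * a ^ (p ^ (k + m) - (i + 1)) * w * hk
  · simp

/-- Let `e` be an element of an `A`-algebra `A'` with `p ^ n * e` the image of a nilpotent `c`.
Then high `p`-power powers of `a + e`, for `a` in `A`, come from `A`. -/
theorem exists_algebraMap_eq_add_pow {p : ℕ} [Fact p.Prime] {A A' B : Type*} [CommRing A]
    [CommRing A'] [CommRing B] [Algebra A A'] [Algebra A B] (hp : IsUnit (p : A')) (a : A)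
    {c : A} (hc : IsNilpotent c) (hcB : algebraMap A B c = 0) {e : A'} {n : ℕ}
    (he : (p : A') ^ n * e = algebraMap A A' c) :
    ∃ M a₂, algebraMap A A' a₂ = (algebraMap A A' a + e) ^ p ^ M ∧
      algebraMap A B a₂ = algebraMap A B a ^ p ^ M := by
  obtain ⟨m, hm⟩ := hc
  have hem : e ^ m = 0 := by
    refine ((hp.pow n).pow m).mul_right_eq_zero.1 ?_
    rw [← mul_pow, he, ← map_pow, hm, map_zero]
  -- Formally $e = c/p^n$, and this `M` makes $p^{nj}$ divide $\binom{p^M}{j}$ for all $j < m$. For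
  -- $j \ge m$ the truncated quotient is harmless, since $c^j = 0$.
  let M := (n + 1) * m
  refine ⟨M, ∑ j ∈ Finset.range (p ^ M + 1),
    c ^ j * a ^ (p ^ M - j) * (((p ^ M).choose j / p ^ (n * j) : ℕ) : A), ?_, ?_⟩
  · rw [add_comm (algebraMap A A' a), add_pow, map_sum]
    refine Finset.sum_congr rfl fun j _ ↦ ?_
    rcases le_or_gt m j with hj | hj
    · rw [pow_eq_zero_of_le hj hm, pow_eq_zero_of_le hj hem]
      simp
    have hdvd : p ^ (n * j) ∣ (p ^ M).choose j := by
      rcases eq_or_ne j 0 with rfl | hj0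
      · simp
      refine (Fact.out : p.Prime).pow_dvd_choose hj0 ?_
      calc n * j + j = (n + 1) * j := by ring
        _ ≤ _ := Nat.mul_le_mul_left _ hj.le
    obtain ⟨w, hw⟩ := hdvd
    rw [hw, Nat.mul_div_cancel_left _ (pow_pos (Fact.out : p.Prime).pos _)]
    simp only [map_mul, map_pow, map_natCast, ← he, Nat.cast_mul, Nat.cast_pow, mul_pow, pow_mul]
    ring
  · rw [map_sum, Finset.sum_eq_single 0]
    · simp
    · intro j _ hj0
      rw [map_mul, map_mul, map_pow, hcB, zero_pow hj0, zero_mul, zero_mul]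
    · simp

theorem IsLocalization.Away.exists_pow_mul_eq_zero {p : ℕ} {A A' : Type*} [CommRing A]
    [CommRing A'] [Algebra A A'] [IsLocalization.Away (p : A) A'] {a : A}
    (h : algebraMap A A' a = 0) : ∃ k : ℕ, (p : A) ^ k * a = 0 := by
  obtain ⟨⟨_, k, rfl⟩, hk⟩ :=
    (IsLocalization.map_eq_zero_iff (Submonoid.powers (p : A)) A' a).1 h
  exact ⟨k, hk⟩

/-- Injectivity of `A^perf → B^perf × A[1/p]^perf`. -/
theorem exists_pow_eq_pow_of_map_eq {p : ℕ} [Fact p.Prime] {A A' B : Type*} [CommRing A]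
    [CommRing A'] [CommRing B] [Algebra A A'] [Algebra A B] [IsLocalization.Away (p : A) A']
    (hnil : ∀ a : A, algebraMap A B a = 0 → IsNilpotent a) {a₁ a₂ : A}
    (hB : algebraMap A B a₁ = algebraMap A B a₂) (hA : algebraMap A A' a₁ = algebraMap A A' a₂) :
    ∃ m, a₁ ^ p ^ m = a₂ ^ p ^ m := by
  obtain ⟨k, hk⟩ := IsLocalization.Away.exists_pow_mul_eq_zero (p := p) (A' := A') (a := a₁ - a₂)
    (by rw [map_sub, hA, sub_self])
  have := exists_add_pow_eq_pow_of_isNilpotent a₂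
    (hnil (a₁ - a₂) (by rw [map_sub, hB, sub_self])) hk
  rwa [add_sub_cancel] at this

open TensorProduct in
/-- Surjectivity of `A^perf → B^perf ×_{B[1/p]^perf} A[1/p]^perf`. -/
theorem exists_map_eq_pow_of_map_eq {p : ℕ} [Fact p.Prime] {A A' B B' : Type*} [CommRing A]
    [CommRing A'] [CommRing B] [CommRing B'] [Algebra A A'] [Algebra A B] [Algebra A' B']
    [Algebra B B'] [IsLocalization.Away (p : A) A'] [IsLocalization.Away (p : B) B']
    (hcomm : ∀ a, algebraMap B B' (algebraMap A B a) = algebraMap A' B' (algebraMap A A' a))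
    [Algebra.IsIntegral A B]
    (hnil : ∀ a : A, algebraMap A B a = 0 → IsNilpotent a)
    (h : ∀ b : B, IsNilpotent (b ⊗ₜ[A] (1 : B) - 1 ⊗ₜ[A] b)) {b : B} {a' : A'}
    (hba : algebraMap B B' b = algebraMap A' B' a') :
    ∃ m a, algebraMap A B a = b ^ p ^ m ∧ algebraMap A A' a = a' ^ p ^ m := by
  have hpu : IsUnit (p : A') := by
    rw [← map_natCast (algebraMap A A')]
    exact IsLocalization.Away.algebraMap_isUnit _
  have hsurj : ∀ x : A', ∃ (k : ℕ) (a : A), (p : A') ^ k * x = algebraMap A A' a := fun x ↦ by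
    obtain ⟨k, a, ha⟩ := IsLocalization.Away.surj (p : A) x
    exact ⟨k, a, by rw [← ha, map_natCast, mul_comm]⟩
  obtain ⟨k, a₀, ha₀⟩ := hsurj a'
  obtain ⟨k', hk'⟩ := IsLocalization.Away.exists_pow_mul_eq_zero (p := p) (A' := B')
    (a := p ^ k * b - algebraMap A B a₀) (by
      rw [map_sub, hcomm, ← ha₀]
      simp [hba])
  obtain ⟨N, a₁, ha₁⟩ := exists_pow_mem_range_of_isNilpotent_tmul_sub (p := p) h
    (b := b) (n := k' + k) ⟨p ^ k' * a₀, by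
      rw [mul_sub, sub_eq_zero] at hk'
      rw [pow_add, mul_assoc, hk', map_mul, map_pow, map_natCast]⟩
  -- The discrepancy between $a'^{p^N}$ and the lift of $b^{p^N}$. It dies in `B'`, so a $p$-power
  -- multiple of it comes from an element of `A` that dies in `B` and is therefore nilpotent.
  let e := a' ^ p ^ N - algebraMap A A' a₁
  have he0 : algebraMap A' B' e = 0 := by
    rw [map_sub, ← hcomm, ha₁, map_pow, map_pow, hba, sub_self]
  obtain ⟨n, c, hc⟩ := hsurj e
  obtain ⟨n', hn'⟩ := IsLocalization.Away.exists_pow_mul_eq_zero (p := p) (A' := B')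
    (a := algebraMap A B c) (by rw [hcomm, ← hc, map_mul, he0, mul_zero])
  have hcB : algebraMap A B (p ^ n' * c) = 0 := by
    rw [map_mul, map_pow, map_natCast, hn']
  obtain ⟨M, a₂, h1, h2⟩ := exists_algebraMap_eq_add_pow (p := p) (B := B) hpu a₁ (hnil _ hcB) hcB
    (e := e) (n := n' + n) (by rw [pow_add, mul_assoc, hc, map_mul, map_pow, map_natCast])
  refine ⟨N + M, a₂, ?_, ?_⟩
  · rw [h2, ha₁, pow_add, pow_mul]
  · rw [h1, add_sub_cancel, pow_add, pow_mul]

/-! ### Elements of the multiplicative perfection -/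

/-- The class in `A^perf` of the element `a` placed at stage `i`. -/
def MulPerf.mk (p : ℕ) {A : Type u} [CommMonoid A] (i : ℕ) (a : A) : MulPerf p A :=
  (⟦⟨i, a⟩⟧ : DirectLimit (fun _ : ℕ ↦ A) (perfTransition p A))

namespace MulPerf

variable {p : ℕ} {A B : Type u} [CommMonoid A] [CommMonoid B]

theorem exists_eq_mk (x : MulPerf p A) : ∃ i a, x = mk p i a :=
  let ⟨i, a, h⟩ := DirectLimit.exists_eq_mk _ x
  ⟨i, a, h⟩

@[simp]
theorem map_mk (φ : A →* B) (i : ℕ) (a : A) : map p φ (mk p i a) = mk p i (φ a) := rfl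

theorem mk_add_pow (i m : ℕ) (a : A) : mk p (i + m) (a ^ p ^ m) = mk p i a := by
  refine Quotient.sound ?_
  exact ⟨i + m, le_rfl, Nat.le_add_right _ _, by simp [perfTransition]⟩

theorem mk_eq_mk_iff {i : ℕ} {a b : A} : mk p i a = mk p i b ↔ ∃ m, a ^ p ^ m = b ^ p ^ m := by
  constructor
  · intro h
    obtain ⟨j, _, _, h⟩ := Quotient.exact h
    exact ⟨j - i, h⟩
  · rintro ⟨m, h⟩
    rw [← mk_add_pow i m a, h, mk_add_pow]

theorem exists_eq_mk_of_le (x : MulPerf p A) : ∃ i, ∀ j, i ≤ j → ∃ a, x = mk p j a := by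
  obtain ⟨i, a, rfl⟩ := x.exists_eq_mk
  refine ⟨i, fun j hij ↦ ?_⟩
  obtain ⟨m, rfl⟩ := Nat.exists_eq_add_of_le hij
  exact ⟨_, (mk_add_pow i m a).symm⟩

theorem exists_common_eq_mk {ι : Type*} [Finite ι] {A : ι → Type u} [∀ j, CommMonoid (A j)]
    (x : ∀ j, MulPerf p (A j)) : ∃ i, ∃ a : ∀ j, A j, ∀ j, x j = mk p i (a j) := by
  choose n hn using fun j ↦ (x j).exists_eq_mk_of_le
  obtain ⟨N, hN⟩ := Finite.exists_le n
  choose a ha using fun j ↦ hn j N (hN j)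
  exact ⟨N, a, ha⟩

end MulPerf

theorem pow_pow_eq_pow_pow_of_le {A : Type*} [Monoid A] {p m n : ℕ} (hmn : m ≤ n) {a b : A}
    (h : a ^ p ^ m = b ^ p ^ m) : a ^ p ^ n = b ^ p ^ n := by
  obtain ⟨k, rfl⟩ := Nat.exists_eq_add_of_le hmn
  rw [pow_add, pow_mul, h, pow_mul]

/-! ### Sections of the perfection sheaf -/

section perfSheaf

open Opposite

variable {p : ℕ} {X : Scheme.{u}}

theorem perfPresheaf_map_mk {U V : (Opens X)ᵒᵖ} (f : U ⟶ V) (i : ℕ) (a : X.presheaf.obj U) :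
    (perfPresheaf p X).map f (MulPerf.mk p i a : MulPerf p (X.presheaf.obj U)) =
      (MulPerf.mk p i (X.presheaf.map f a) : MulPerf p (X.presheaf.obj V)) := rfl

instance : Presheaf.IsLocallyInjective (Opens.grothendieckTopology X) (toPerfSheaf p X) :=
  inferInstanceAs (Presheaf.IsLocallyInjective _ (toSheafify _ (perfPresheaf p X)))

instance : Presheaf.IsLocallySurjective (Opens.grothendieckTopology X) (toPerfSheaf p X) :=
  inferInstanceAs (Presheaf.IsLocallySurjective _ (toSheafify _ (perfPresheaf p X)))

theorem perfSheaf_map_toPerfSheaf_app {U V : (Opens X)ᵒᵖ} (f : U ⟶ V)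
    (s : (perfPresheaf p X).obj U) :
    (perfSheaf p X).obj.map f ((toPerfSheaf p X).app U s) =
      (toPerfSheaf p X).app V ((perfPresheaf p X).map f s) :=
  (NatTrans.naturality_apply (toPerfSheaf p X) f s).symm

/-- Representatives of sections with equal images agree locally after a $p^m$-th power with $m$
depending on the point; compactness bounds $m$, and the structure sheaf is separated. -/
theorem toPerfSheaf_app_injective {U : X.Opens} (hU : IsCompact (U : Set X)) :
    Function.Injective ((toPerfSheaf p X).app (op U)) := by
  intro s t hst
  have hloc := Presheaf.equalizerSieve_mem (Opens.grothendieckTopology X) (toPerfSheaf p X) s t hst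
  obtain ⟨i, a, ha⟩ := MulPerf.exists_common_eq_mk (p := p) (ι := Bool)
    (A := fun _ ↦ X.presheaf.obj (op U)) (fun b ↦ if b then s else t)
  have hs : s = MulPerf.mk p i (a true) := ha true
  have ht : t = MulPerf.mk p i (a false) := ha false
  have hpt : ∀ x : U, ∃ V : X.Opens, x.1 ∈ V ∧ ∃ (hVU : V ≤ U) (m : ℕ),
      X.presheaf.map (homOfLE hVU).op (a true) ^ p ^ m =
      X.presheaf.map (homOfLE hVU).op (a false) ^ p ^ m := by
    rintro ⟨x, hx⟩
    obtain ⟨V, f, hf, hxV⟩ := hloc x hx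
    refine ⟨V, hxV, f.le, ?_⟩
    have h1 : (perfPresheaf p X).map f.op s = (perfPresheaf p X).map f.op t := hf
    rw [hs, ht] at h1
    exact MulPerf.mk_eq_mk_iff.1 h1
  choose V hxV hVU m hm using hpt
  obtain ⟨T, hT⟩ := hU.elim_finite_subcover (fun x : U ↦ (V x : Set X)) (fun x ↦ (V x).2)
    (fun x hx ↦ Set.mem_iUnion.2 ⟨⟨x, hx⟩, hxV _⟩)
  obtain ⟨M, hM⟩ := Finite.exists_le fun x : T ↦ m x
  rw [hs, ht]
  refine MulPerf.mk_eq_mk_iff.2 ⟨M, ?_⟩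
  refine X.sheaf.eq_of_locally_eq' (fun x : T ↦ V x) U (fun x ↦ homOfLE (hVU x)) ?_ _ _ fun x ↦ ?_
  · intro x hx
    obtain ⟨y, hy, hxy⟩ := Set.mem_iUnion₂.1 (hT hx)
    exact Opens.mem_iSup.2 ⟨⟨y, hy⟩, hxy⟩
  · refine (map_pow _ _ _).trans (Eq.trans ?_ (map_pow _ _ _).symm)
    exact pow_pow_eq_pow_pow_of_le (hM x) (hm x)

/-- A section of `𝒪_X^perf` that comes from the presheaf on each member of a finite cover with
compact pairwise intersections comes from the presheaf. -/
theorem exists_toPerfSheaf_app_eq_of_finite_cover {U : X.Opens} {ι : Type*} [Finite ι]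
    (V : ι → X.Opens) (hVU : ∀ i, V i ≤ U) (hcov : U ≤ iSup V)
    (hVV : ∀ i j, IsCompact ((V i ⊓ V j : X.Opens) : Set X))
    (σ : (perfSheaf p X).obj.obj (op U)) (τ : ∀ i, (perfPresheaf p X).obj (op (V i)))
    (hτ : ∀ i, (toPerfSheaf p X).app _ (τ i) = (perfSheaf p X).obj.map (homOfLE (hVU i)).op σ) :
    ∃ s, (toPerfSheaf p X).app (op U) s = σ := by
  obtain ⟨n, a, ha⟩ := MulPerf.exists_common_eq_mk (p := p)
    (A := fun i ↦ X.presheaf.obj (op (V i))) τ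
  have hov : ∀ ij : ι × ι, ∃ m : ℕ,
      X.presheaf.map (Opens.infLELeft (V ij.1) (V ij.2)).op (a ij.1) ^ p ^ m =
      X.presheaf.map (Opens.infLERight (V ij.1) (V ij.2)).op (a ij.2) ^ p ^ m := by
    rintro ⟨i, j⟩
    have h1 : (perfPresheaf p X).map (Opens.infLELeft (V i) (V j)).op (τ i) =
        (perfPresheaf p X).map (Opens.infLERight (V i) (V j)).op (τ j) := by
      apply toPerfSheaf_app_injective (hVV i j)
      rw [NatTrans.naturality_apply, NatTrans.naturality_apply, hτ, hτ,
        ← ConcreteCategory.comp_apply, ← ConcreteCategory.comp_apply, ← Functor.map_comp,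
        ← Functor.map_comp]
      rfl
    rw [ha, ha] at h1
    exact MulPerf.mk_eq_mk_iff.1 h1
  choose m hm using hov
  obtain ⟨M, hM⟩ := Finite.exists_le m
  obtain ⟨b, hb⟩ : ∃ b : X.presheaf.obj (op U), ∀ i,
      X.presheaf.map (homOfLE (hVU i)).op b = (a i ^ p ^ M : X.presheaf.obj (op (V i))) :=
    (X.sheaf.existsUnique_gluing' V U (fun i ↦ homOfLE (hVU i)) hcov
    (fun i ↦ (a i ^ p ^ M : X.presheaf.obj (op (V i)))) (by
      intro i j
      refine (map_pow _ _ _).trans (Eq.trans ?_ (map_pow _ _ _).symm)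
      exact pow_pow_eq_pow_pow_of_le (hM (i, j)) (hm (i, j)))).exists
  -- The section `b` glues the $p^M$-th powers of representatives at stage `n`, hence belongs to
  -- stage `n + M`.
  refine ⟨(MulPerf.mk p (n + M) b : MulPerf p (X.presheaf.obj (op U))), ?_⟩
  refine (perfSheaf p X).eq_of_locally_eq' V U (fun i ↦ homOfLE (hVU i)) hcov _ _ fun i ↦ ?_
  have hbi : (perfPresheaf p X).map (homOfLE (hVU i)).op
      (MulPerf.mk p (n + M) b : MulPerf p (X.presheaf.obj (op U))) = τ i := by
    rw [perfPresheaf_map_mk, hb, ha]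
    exact MulPerf.mk_add_pow n M (a i)
  exact (perfSheaf_map_toPerfSheaf_app _ _).trans ((congrArg _ hbi).trans (hτ i))

/-- Local lifts can be taken on finitely many basic opens, whose pairwise intersections are again
basic, hence compact, so the lifts glue. -/
theorem toPerfSheaf_app_bijective {U : X.Opens} (hU : IsAffineOpen U) :
    Function.Bijective ((toPerfSheaf p X).app (op U)) := by
  refine ⟨toPerfSheaf_app_injective hU.isCompact, fun σ ↦ ?_⟩
  have hloc := Presheaf.imageSieve_mem (Opens.grothendieckTopology X) (toPerfSheaf p X)
    (U := op U) σ
  have hpt : ∀ x : U, ∃ f : Γ(X, U), x.1 ∈ X.basicOpen f ∧ ∃ τ,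
      (toPerfSheaf p X).app (op (X.basicOpen f)) τ =
        (perfSheaf p X).obj.map (homOfLE (X.basicOpen_le f)).op σ := by
    rintro ⟨x, hx⟩
    obtain ⟨V, g, ⟨τ, hτ⟩, hxV⟩ := hloc x hx
    obtain ⟨f, hfV, hxf⟩ := hU.exists_basicOpen_le ⟨x, hxV⟩ hx
    refine ⟨f, hxf, (perfPresheaf p X).map (homOfLE hfV).op τ, ?_⟩
    rw [← perfSheaf_map_toPerfSheaf_app, hτ, ← ConcreteCategory.comp_apply, ← Functor.map_comp]
    rfl
  choose f hxf τ hτ using hpt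
  obtain ⟨T, hT⟩ := hU.isCompact.elim_finite_subcover (fun x : U ↦ (X.basicOpen (f x) : Set X))
    (fun x ↦ (X.basicOpen (f x)).2) (fun x hx ↦ Set.mem_iUnion.2 ⟨⟨x, hx⟩, hxf _⟩)
  refine exists_toPerfSheaf_app_eq_of_finite_cover (fun x : T ↦ X.basicOpen (f x))
    (fun x ↦ X.basicOpen_le _) (fun x hx ↦ ?_) (fun x y ↦ ?_) σ (fun x ↦ τ x) (fun x ↦ hτ x)
  · obtain ⟨y, hy, hxy⟩ := Set.mem_iUnion₂.1 (hT hx)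
    exact Opens.mem_iSup.2 ⟨⟨y, hy⟩, hxy⟩
  · rw [← X.basicOpen_mul]
    exact (hU.basicOpen _).isCompact

end perfSheaf

/-! ### Cartesian squares tested on a basis -/

open Opposite in
/-- A commutative square of sheaves of monoids is Cartesian if it is so on sections over the
members of a basis of open sets. -/
theorem TopCat.Sheaf.isPullback_of_isBasis {X : TopCat.{u}} {F G H K : TopCat.Sheaf MonCat.{u} X}
    {a : F ⟶ G} {b : F ⟶ H} {c : G ⟶ K} {d : H ⟶ K} (w : a ≫ c = b ≫ d)
    {B : Set (Opens X)} (hB : Opens.IsBasis B)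
    (hinj : ∀ U ∈ B, ∀ s t : F.1.obj (op U), a.hom.app (op U) s = a.hom.app (op U) t →
      b.hom.app (op U) s = b.hom.app (op U) t → s = t)
    (hsurj : ∀ U ∈ B, ∀ (s : G.1.obj (op U)) (t : H.1.obj (op U)),
      c.hom.app (op U) s = d.hom.app (op U) t →
      ∃ r, a.hom.app (op U) r = s ∧ b.hom.app (op U) r = t) :
    IsPullback a b c d := by
  let ι (U : Opens X) := {V : Opens X // V ∈ B ∧ V ≤ U}
  have hcov : ∀ U : Opens X, U ≤ iSup fun V : ι U ↦ V.1 := fun U x hx ↦ by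
    obtain ⟨V, hV, hxV, hVU⟩ := Opens.isBasis_iff_nbhd.1 hB hx
    exact Opens.mem_iSup.2 ⟨⟨V, hV, hVU⟩, hxV⟩
  have nat : ∀ {F G : TopCat.Sheaf MonCat.{u} X} (a : F ⟶ G) {U V : Opens X} (i : V ⟶ U)
      (s : F.1.obj (op U)),
      G.1.map i.op (a.hom.app (op U) s) = a.hom.app (op V) (F.1.map i.op s) :=
    fun a _ _ i s ↦ (NatTrans.naturality_apply a.hom i.op s).symm
  -- Injectivity is needed on every open set: the intersection of two basis members, where the
  -- gluing condition is checked, need not be in the basis.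
  have hinj' : ∀ (U : Opens X) (s t : F.1.obj (op U)), a.hom.app (op U) s = a.hom.app (op U) t →
      b.hom.app (op U) s = b.hom.app (op U) t → s = t := by
    intro U s t ha hb
    refine F.eq_of_locally_eq' (fun V : ι U ↦ V.1) U (fun V ↦ homOfLE V.2.2) (hcov U) s t
      fun V ↦ hinj V.1 V.2.1 _ _ ?_ ?_
    · rw [← nat, ← nat, ha]
    · rw [← nat, ← nat, hb]
  have hw : ∀ U (s : F.1.obj (op U)),
      c.hom.app (op U) (a.hom.app (op U) s) = d.hom.app (op U) (b.hom.app (op U) s) :=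
    fun U s ↦ congr($(w).hom.app (op U) s)
  have hsurj' : ∀ (U : Opens X) (s : G.1.obj (op U)) (t : H.1.obj (op U)),
      c.hom.app (op U) s = d.hom.app (op U) t →
      ∃ r, a.hom.app (op U) r = s ∧ b.hom.app (op U) r = t := by
    intro U s t hst
    have hloc : ∀ V : ι U, ∃ r : F.1.obj (op V.1),
        a.hom.app (op V.1) r = G.1.map (homOfLE V.2.2).op s ∧
        b.hom.app (op V.1) r = H.1.map (homOfLE V.2.2).op t := fun V ↦
      hsurj V.1 V.2.1 _ _ (by rw [← nat, ← nat, hst])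
    choose r hra hrb using hloc
    have compat : ∀ {G : TopCat.Sheaf MonCat.{u} X} (a : F ⟶ G) (s : G.1.obj (op U)),
        (∀ V, a.hom.app (op V.1) (r V) = G.1.map (homOfLE V.2.2).op s) → ∀ V W : ι U,
        a.hom.app (op (V.1 ⊓ W.1)) (F.1.map (Opens.infLELeft V.1 W.1).op (r V)) =
        a.hom.app (op (V.1 ⊓ W.1)) (F.1.map (Opens.infLERight V.1 W.1).op (r W)) := by
      intro G a s h V W
      rw [← nat, ← nat, h, h, ← ConcreteCategory.comp_apply, ← ConcreteCategory.comp_apply,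
        ← Functor.map_comp, ← Functor.map_comp]
      rfl
    obtain ⟨x, hx, -⟩ := F.existsUnique_gluing' (fun V : ι U ↦ V.1) U (fun V ↦ homOfLE V.2.2)
      (hcov U) r (fun V W ↦ hinj' _ _ _ (compat a s hra V W) (compat b t hrb V W))
    refine ⟨x, ?_, ?_⟩
    · refine G.eq_of_locally_eq' (fun V : ι U ↦ V.1) U (fun V ↦ homOfLE V.2.2) (hcov U) _ _
        fun V ↦ (nat a _ x).trans ((congrArg _ (hx V)).trans (hra V))
    · refine H.eq_of_locally_eq' (fun V : ι U ↦ V.1) U (fun V ↦ homOfLE V.2.2) (hcov U) _ _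
        fun V ↦ (nat b _ x).trans ((congrArg _ (hx V)).trans (hrb V))
  refine IsPullback.of_map (sheafToPresheaf (Opens.grothendieckTopology X) MonCat.{u}) w
    (IsPullback.of_forall_isPullback_app fun U ↦ IsPullback.of_map (CategoryTheory.forget MonCat.{u}) ?_ ?_)
  · exact congr($(w).hom.app U)
  · refine (Limits.Types.isPullback_iff _ _ _ _).2 ⟨?_, ?_, ?_⟩
    · ext s
      exact hw U.unop s
    · rintro s t ⟨h1, h2⟩
      exact hinj' U.unop s t h1 h2
    · exact hsurj' U.unop

/-! ### The square of perfections -/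

namespace MulPerf

theorem eq_of_map_eq_of_map_eq {p : ℕ} [Fact p.Prime] {A A' B : Type u} [CommRing A]
    [CommRing A'] [CommRing B] [Algebra A A'] [Algebra A B] [IsLocalization.Away (p : A) A']
    (hnil : ∀ a : A, algebraMap A B a = 0 → IsNilpotent a) {x y : MulPerf p A}
    (hB : map p (algebraMap A B : A →* B) x = map p (algebraMap A B : A →* B) y)
    (hA : map p (algebraMap A A' : A →* A') x = map p (algebraMap A A' : A →* A') y) :
    x = y := by
  obtain ⟨i, c, hc⟩ := exists_common_eq_mk (p := p) (ι := Bool) (A := fun _ ↦ A)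
    (fun b ↦ if b then x else y)
  have hx : x = mk p i (c true) := hc true
  have hy : y = mk p i (c false) := hc false
  rw [hx, hy, map_mk, map_mk, mk_eq_mk_iff] at hA hB
  obtain ⟨m, hm⟩ := hB
  obtain ⟨n, hn⟩ := hA
  obtain ⟨k, hk⟩ := exists_pow_eq_pow_of_map_eq (p := p) (A' := A') hnil
    (a₁ := c true ^ p ^ (m + n)) (a₂ := c false ^ p ^ (m + n))
    (by rw [map_pow, map_pow]; exact pow_pow_eq_pow_pow_of_le (Nat.le_add_right m n) hm)
    (by rw [map_pow, map_pow]; exact pow_pow_eq_pow_pow_of_le (Nat.le_add_left n m) hn)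
  rw [hx, hy, mk_eq_mk_iff]
  exact ⟨m + n + k, by rw [pow_add, pow_mul, hk, pow_mul]⟩

open TensorProduct in
theorem exists_map_eq_of_map_eq {p : ℕ} [Fact p.Prime] {A A' B B' : Type u} [CommRing A]
    [CommRing A'] [CommRing B] [CommRing B'] [Algebra A A'] [Algebra A B] [Algebra A' B']
    [Algebra B B'] [IsLocalization.Away (p : A) A'] [IsLocalization.Away (p : B) B']
    (hcomm : ∀ a, algebraMap B B' (algebraMap A B a) = algebraMap A' B' (algebraMap A A' a))
    [Algebra.IsIntegral A B]
    (hnil : ∀ a : A, algebraMap A B a = 0 → IsNilpotent a)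
    (h : ∀ b : B, IsNilpotent (b ⊗ₜ[A] (1 : B) - 1 ⊗ₜ[A] b)) {x : MulPerf p B} {y : MulPerf p A'}
    (hxy : map p (algebraMap B B' : B →* B') x = map p (algebraMap A' B' : A' →* B') y) :
    ∃ z, map p (algebraMap A B : A →* B) z = x ∧ map p (algebraMap A A' : A →* A') z = y := by
  obtain ⟨i, hi⟩ := x.exists_eq_mk_of_le
  obtain ⟨j, hj⟩ := y.exists_eq_mk_of_le
  obtain ⟨b, rfl⟩ := hi (i + j) (Nat.le_add_right _ _)
  obtain ⟨a', rfl⟩ := hj (i + j) (Nat.le_add_left _ _)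
  rw [map_mk, map_mk, mk_eq_mk_iff] at hxy
  obtain ⟨m, hm⟩ := hxy
  obtain ⟨n, a, hab, haa'⟩ := exists_map_eq_pow_of_map_eq (p := p) hcomm hnil h
    (b := b ^ p ^ m) (a' := a' ^ p ^ m) (by rw [map_pow, map_pow]; exact hm)
  -- The `m` extra stages make `b` and `a'` agree in `B'`; the `n` further ones produce the common
  -- lift.
  refine ⟨mk p (i + j + (m + n)) a, ?_, ?_⟩
  · rw [map_mk, ← mk_add_pow (i + j) (m + n), pow_add, pow_mul]
    exact congrArg _ hab
  · rw [map_mk, ← mk_add_pow (i + j) (m + n), pow_add, pow_mul]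
    exact congrArg _ haa'

end MulPerf

/-! ### Universal homeomorphisms over affine opens -/

namespace IsUniversalHomeomorphism

theorem isHomeomorph {X Y : Scheme.{u}} {f : X ⟶ Y} (hf : IsUniversalHomeomorphism f) :
    IsHomeomorph f := hf _ _ _ .of_id_snd

/-- Integral means affine and universally closed; affineness holds because `f` is topologically
inducing with closed range. -/
theorem isIntegralHom {X Y : Scheme.{u}} {f : X ⟶ Y} (hf : IsUniversalHomeomorphism f) :
    IsIntegralHom f := by
  refine IsIntegralHom.iff_universallyClosed_and_isAffineHom.2 ⟨⟨?_⟩, ?_⟩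
  · exact fun _ _ i g k h ↦ (hf i g k h).isClosedMap
  · have := hf.isHomeomorph
    exact isAffineHom_of_isInducing f this.isInducing (this.surjective.range_eq ▸ isClosed_univ)

theorem universallyInjective {X Y : Scheme.{u}} {f : X ⟶ Y} (hf : IsUniversalHomeomorphism f) :
    UniversallyInjective f :=
  ⟨fun _ _ i g k h ↦ (hf i g k h).injective⟩

/-- The basic open of `a` has empty preimage, so it is empty by surjectivity of `f`. -/
theorem isNilpotent_of_app_eq_zero {X Y : Scheme.{u}} {f : X ⟶ Y}
    (hf : IsUniversalHomeomorphism f) {V : Y.Opens} (hV : IsAffineOpen V) (a : Γ(Y, V))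
    (ha : f.app V a = 0) : IsNilpotent a := by
  rw [Scheme.isNilpotent_iff_basicOpen_eq_bot_of_isCompact hV.isCompact]
  have h1 : f ⁻¹ᵁ (Y.basicOpen a) = ⊥ := by
    rw [Scheme.preimage_basicOpen, ha, Scheme.basicOpen_zero]
  refine Opens.ext (Set.eq_empty_of_forall_notMem fun y hy ↦ ?_)
  obtain ⟨x, rfl⟩ := hf.isHomeomorph.surjective y
  have : x ∈ f ⁻¹ᵁ (Y.basicOpen a) := hy
  rw [h1] at this
  exact this

end IsUniversalHomeomorphism

open TensorProduct in
-- For a prime `P` of the tensor square, the two coprojections give points of `X` with values in the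
-- residue field of `P` and the same image in `Y`. Universal injectivity identifies them, so the
-- difference lies in every prime.
theorem AlgebraicGeometry.UniversallyInjective.isNilpotent_tmul_sub {X Y : Scheme.{u}} (f : X ⟶ Y)
    [UniversallyInjective f] {V : Y.Opens} (hV : IsAffineOpen V) (hW : IsAffineOpen (f ⁻¹ᵁ V)) :
    letI := (f.app V).hom.toAlgebra
    ∀ b : Γ(X, f ⁻¹ᵁ V), IsNilpotent (b ⊗ₜ[Γ(Y, V)] (1 : Γ(X, f ⁻¹ᵁ V)) - 1 ⊗ₜ[Γ(Y, V)] b) := by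
  let := (f.app V).hom.toAlgebra
  intro b
  rw [← mem_nilradical, nilradical_eq_sInf, Ideal.mem_sInf]
  intro P (hP : P.IsPrime)
  let l : Γ(X, f ⁻¹ᵁ V) ⟶ CommRingCat.of P.ResidueField := CommRingCat.ofHom
    ((algebraMap _ P.ResidueField).comp
      (Algebra.TensorProduct.includeLeft (R := Γ(Y, V)) (S := Γ(Y, V)) (A := Γ(X, f ⁻¹ᵁ V))
        (B := Γ(X, f ⁻¹ᵁ V))).toRingHom)
  let r : Γ(X, f ⁻¹ᵁ V) ⟶ CommRingCat.of P.ResidueField := CommRingCat.ofHom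
    ((algebraMap _ P.ResidueField).comp
      (Algebra.TensorProduct.includeRight (R := Γ(Y, V)) (A := Γ(X, f ⁻¹ᵁ V))
        (B := Γ(X, f ⁻¹ᵁ V))).toRingHom)
  have hlr : f.app V ≫ l = f.app V ≫ r := by
    ext a
    exact congrArg (algebraMap (Γ(X, f ⁻¹ᵁ V) ⊗[Γ(Y, V)] Γ(X, f ⁻¹ᵁ V)) P.ResidueField)
      (Algebra.TensorProduct.tmul_one_eq_one_tmul a)
  have hsq : Spec.map (f.app V) ≫ hV.fromSpec = hW.fromSpec ≫ f := by
    rw [← Scheme.Hom.appLE_eq_app]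
    exact hV.SpecMap_appLE_fromSpec f hW _
  have hinj := ((tfae_universallyInjective f).out 0 1).1 ‹_›
  have h1 : Spec.map l ≫ hW.fromSpec = Spec.map r ≫ hW.fromSpec := by
    refine hinj P.ResidueField ?_
    change (Spec.map l ≫ hW.fromSpec) ≫ f = (Spec.map r ≫ hW.fromSpec) ≫ f
    rw [Category.assoc, Category.assoc, ← hsq, ← Spec.map_comp_assoc, hlr, Spec.map_comp_assoc]
  have h2 : l = r := Spec.map_injective ((cancel_mono _).1 h1)
  rw [← Ideal.algebraMap_residueField_eq_zero, map_sub, sub_eq_zero]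
  exact congr($(h2).hom b)

/-! ### The rational fibre as inversion of $p$ -/

/-- A base change of `ℤ → ℚ` to a ring in which all integers prime to `p` are invertible inverts
`p`. -/
theorem CommRingCat.isLocalization_away_of_isPushout {p : ℕ} [Fact p.Prime]
    {R K A A' : CommRingCat.{u}} {r : R ⟶ A} {k : R ⟶ K} {ι : A ⟶ A'} {k' : K ⟶ A'}
    (h : IsPushout r k ι k') (eR : R ≃+* ℤ) (eK : K ≃+* ℚ)
    (hA : ∀ n : ℤ, ¬ (p : ℤ) ∣ n → IsUnit (n : A)) :
    letI := ι.hom.toAlgebra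
    IsLocalization.Away (p : A) A' := by
  let := ι.hom.toAlgebra
  let := r.hom.toAlgebra
  let := k.hom.toAlgebra
  let := k'.hom.toAlgebra
  let : Algebra R A' := (r ≫ ι).hom.toAlgebra
  have : IsScalarTower R A A' := .of_algebraMap_eq' rfl
  have : IsScalarTower R K A' := .of_algebraMap_eq' congr($(h.w).hom)
  have hpo : Algebra.IsPushout R A K A' := CommRingCat.isPushout_iff_isPushout.1 h
  let M : Submonoid R := (nonZeroDivisors ℤ).map (Int.castRingHom R)
  have hR : ∀ x : R, x = ((eR x : ℤ) : R) := fun x ↦ eR.injective (by simp)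
  have hkn : ∀ n : ℤ, algebraMap R K n = n := fun n ↦ map_intCast _ n
  have hM : IsLocalization M K := by
    refine ⟨?_, ?_, ?_⟩
    · rintro ⟨_, n, hn, rfl⟩
      rw [← MulEquiv.isUnit_map eK]
      have : (n : ℚ) ≠ 0 := by exact_mod_cast nonZeroDivisors.ne_zero hn
      simpa using this
    · intro z
      refine ⟨⟨((eK z).num : R), ⟨((eK z).den : R), ((eK z).den : ℤ), ?_, by simp⟩⟩, ?_⟩
      · exact mem_nonZeroDivisors_of_ne_zero (by exact_mod_cast (eK z).den_ne_zero)
      · apply eK.injective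
        simp [Rat.mul_den_eq_num]
    · intro x y hxy
      refine ⟨1, ?_⟩
      rw [hR x, hR y, hkn, hkn] at hxy
      have := congrArg eK hxy
      simp only [map_intCast, Int.cast_inj] at this
      rw [eR.injective this]
  have hM' : IsLocalization (Algebra.algebraMapSubmonoid A M) A' :=
    (Algebra.isLocalization_iff_isPushout M K).2 hpo
  have hle : Submonoid.powers (p : A) ≤ Algebra.algebraMapSubmonoid A M := by
    rw [Submonoid.powers_le]
    refine ⟨(p : R), ⟨p, mem_nonZeroDivisors_of_ne_zero ?_, by simp⟩, by simp⟩
    exact_mod_cast (Fact.out : p.Prime).ne_zero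
  -- Write $n = p^e m$ with $p \nmid m$. As $m$ is a unit, $n$ divides $p^e$ in `A`, so inverting
  -- $p$ already inverts all nonzero integers.
  have hdvd : ∀ x ∈ Algebra.algebraMapSubmonoid A M, ∃ (n : ℕ) (c : A), (p : A) ^ n = x * c := by
    rintro _ ⟨_, ⟨n, hn, rfl⟩, rfl⟩
    obtain ⟨m, hm, hpm⟩ := (Int.finiteMultiplicity_iff.2
      ⟨by simpa using (Fact.out : p.Prime).ne_one, nonZeroDivisors.ne_zero hn⟩ :
        FiniteMultiplicity (p : ℤ) n).exists_eq_pow_mul_and_not_dvd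
    obtain ⟨v, hv⟩ := (hA m hpm).exists_right_inv
    generalize multiplicity (p : ℤ) n = e at hm
    refine ⟨e, v, ?_⟩
    have h1 : algebraMap R A (Int.castRingHom R n) = (n : A) := by simp
    rw [h1, hm, Int.cast_mul, Int.cast_pow, Int.cast_natCast, mul_assoc, hv, mul_one]
  refine ⟨fun y ↦ IsLocalization.map_units A' ⟨y.1, hle y.2⟩, fun z ↦ ?_, fun {x y} hxy ↦ ?_⟩
  · obtain ⟨⟨a, y⟩, hay⟩ := IsLocalization.surj (Algebra.algebraMapSubmonoid A M) z
    obtain ⟨n, c, hn⟩ := hdvd y y.2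
    exact ⟨⟨a * c, ⟨_, n, rfl⟩⟩, by simp only [hn, map_mul, ← hay, mul_assoc]⟩
  · obtain ⟨y, hy⟩ := (IsLocalization.eq_iff_exists (Algebra.algebraMapSubmonoid A M) A').1 hxy
    obtain ⟨n, c, hn⟩ := hdvd y y.2
    refine ⟨⟨_, n, rfl⟩, ?_⟩
    simp only [hn]
    linear_combination c * hy

/-- On a scheme over `ℤ_(p)`, integers prime to `p` are invertible. -/
theorem isUnit_intCast_of_over_specZLocalized (p : ℕ) [Fact p.Prime] {X : Scheme.{u}}
    [X.Over (SpecZLocalized.{u} p)] (U : X.Opens) {n : ℤ} (hn : ¬ (p : ℤ) ∣ n) :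
    IsUnit (n : Γ(X, U)) := by
  let g : Localization.AtPrime (Ideal.span {(p : ℤ)}) →+* Γ(X, U) :=
    ((X ↘ SpecZLocalized.{u} p).appLE ⊤ U le_top).hom.comp
      ((Scheme.ΓSpecIso _).inv.hom.comp ULift.ringEquiv.symm.toRingHom)
  have h1 : IsUnit (algebraMap ℤ (Localization.AtPrime (Ideal.span {(p : ℤ)})) n) :=
    IsLocalization.map_units _ (⟨n, fun h ↦ hn (Ideal.mem_span_singleton.1 h)⟩ :
      (Ideal.span {(p : ℤ)}).primeCompl)
  have h2 := h1.map g
  rwa [eq_intCast, map_intCast] at h2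

/-- Restricted to `U`, the fibre square defining the rational fibre is one of affine schemes, so
global sections turn it into a pushout of rings. -/
theorem isLocalization_away_rationalFiberι_app (p : ℕ) [Fact p.Prime] {X : Scheme.{u}}
    [X.Over (SpecZLocalized.{u} p)] {U : X.Opens} (hU : IsAffineOpen U) :
    letI := ((rationalFiberι X).app U).hom.toAlgebra
    IsLocalization.Away (p : Γ(X, U)) Γ(rationalFiber X, rationalFiberι X ⁻¹ᵁ U) := by
  have hpb : IsPullback (rationalFiberι X) (Limits.pullback.snd _ _)
    (specULiftZIsTerminal.from X) (specULiftZIsTerminal.from SpecRat.{u}) :=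
    IsPullback.of_hasPullback _ _
  have hpb' := (isPullback_morphismRestrict (rationalFiberι X) U).paste_vert hpb
  have : IsAffine U := hU
  have key := CommRingCat.isLocalization_away_of_isPushout (p := p)
    (isPushout_appTop_of_isPullback hpb')
    ((Scheme.ΓSpecIso _).commRingCatIsoToRingEquiv.trans ULift.ringEquiv)
    ((Scheme.ΓSpecIso _).commRingCatIsoToRingEquiv.trans ULift.ringEquiv)
    (fun n hn ↦ isUnit_intCast_of_over_specZLocalized p (U.ι ''ᵁ ⊤) hn)
  rw [← Scheme.Hom.appLE_eq_app]
  rw [Scheme.Hom.appTop, morphismRestrict_app'] at key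
  exact ((rationalFiberι X).appLE_congr _ (Scheme.Opens.ι_image_top _) (Scheme.Opens.ι_image_top _)
    (fun {R S} g ↦ letI := g.hom.toAlgebra; IsLocalization.Away (p : R) S)).1 key

/-! ### Pullback on sections and the Cartesian square -/

section pullback

open Opposite

variable {p : ℕ}

theorem perfPullback_app_toPerfSheaf {X Y : Scheme.{u}} (f : X ⟶ Y) (U : Y.Opens)
    (s : (perfPresheaf p Y).obj (op U)) :
    (perfPullback p f).hom.app (op U) ((toPerfSheaf p Y).app (op U) s) =
      (toPerfSheaf p X).app (op (f ⁻¹ᵁ U)) ((mulPerfFunctor p).map (f.app U) s) := by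
  have h := toSheafify_sheafifyLift (Opens.grothendieckTopology Y)
    (perfPresheafPullback p f ≫
      (TopCat.Presheaf.pushforward MonCat.{u} f.base).map (toPerfSheaf p X))
    ((TopCat.Sheaf.pushforward MonCat.{u} f.base).obj (perfSheaf p X)).property
  exact congr($(h).app (op U) s)

theorem perfPullbackOver_app_toPerfSheaf {W X Y : Scheme.{u}} (g : W ⟶ X) (f : X ⟶ Y)
    (h : W ⟶ Y) (w : g ≫ f = h) (U : Y.Opens) (s : (perfPresheaf p X).obj (op (f ⁻¹ᵁ U))) :
    (perfPullbackOver p g f h w).hom.app (op U) ((toPerfSheaf p X).app (op (f ⁻¹ᵁ U)) s) =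
      (toPerfSheaf p W).app (op (h ⁻¹ᵁ U)) ((mulPerfFunctor p).map
        (g.appLE (f ⁻¹ᵁ U) (h ⁻¹ᵁ U) (by rw [← w, Scheme.Hom.comp_preimage])) s) := by
  subst w
  have h1 := perfPullback_app_toPerfSheaf (p := p) g (f ⁻¹ᵁ U) s
  have h2 : g.appLE (f ⁻¹ᵁ U) ((g ≫ f) ⁻¹ᵁ U) (Scheme.Hom.comp_preimage _ _ _).le =
      g.app (f ⁻¹ᵁ U) :=
    Scheme.Hom.appLE_eq_app _
  rw [h2]
  -- After the substitution, the transport in `perfPullbackOver` is restriction along an identity.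
  refine Eq.trans ?_ h1
  change (perfSheaf p W).obj.map (𝟙 _) _ = _
  rw [CategoryTheory.Functor.map_id]
  rfl

end pullback

theorem lemma1p10 (p : ℕ) [Fact p.Prime] {X Y : Scheme.{u}}
    [X.Over (SpecZLocalized.{u} p)] [Y.Over (SpecZLocalized.{u} p)]
    (f : X ⟶ Y) [f.IsOver (SpecZLocalized.{u} p)] (hf : IsUniversalHomeomorphism f) :
    IsPullback
      (perfPullback p f)
      (perfPullback p (rationalFiberι Y))
      (perfPullbackOver p (rationalFiberι X) f (rationalFiberι X ≫ f) rfl)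
      (perfPullbackOver p (rationalFiberMap f) (rationalFiberι Y) (rationalFiberι X ≫ f)
        (rationalFiberMap_comp_ι f)) := by
  have hint : IsIntegralHom f := hf.isIntegralHom
  have hui : UniversallyInjective f := hf.universallyInjective
  have hι : ∀ Z : Scheme.{u}, IsAffineHom (rationalFiberι Z) := fun Z ↦
    isAffineHom_isStableUnderBaseChange.of_isPullback (IsPullback.of_hasPullback
      (specULiftZIsTerminal.from Z) (specULiftZIsTerminal.from SpecRat.{u})).flip inferInstance
  have hcomm : ∀ V : Y.Opens,
      f.app V ≫ (rationalFiberι X).appLE (f ⁻¹ᵁ V) ((rationalFiberι X ≫ f) ⁻¹ᵁ V)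
        (Scheme.Hom.comp_preimage _ _ _).le =
      (rationalFiberι Y).app V ≫ (rationalFiberMap f).appLE (rationalFiberι Y ⁻¹ᵁ V)
        ((rationalFiberι X ≫ f) ⁻¹ᵁ V) (by rw [← rationalFiberMap_comp_ι, Scheme.Hom.comp_preimage]) := by
    intro V
    rw [← Scheme.Hom.appLE_eq_app, ← Scheme.Hom.appLE_eq_app, Scheme.Hom.appLE_comp_appLE,
      Scheme.Hom.appLE_comp_appLE]
    simp only [rationalFiberMap_comp_ι]
  refine TopCat.Sheaf.isPullback_of_isBasis ?_ Y.isBasis_affineOpens ?_ ?_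
  -- Maps from a sheafification into a sheaf are determined on the presheaf, where commutativity
  -- reduces to `hcomm`.
  · refine CategoryTheory.Sheaf.hom_ext (sheafify_hom_ext _ _ _
      ((TopCat.Sheaf.pushforward MonCat.{u} (rationalFiberι X ≫ f).base).obj
        (perfSheaf p (rationalFiber X))).property ?_)
    ext U s
    have h1 := (congrArg _ (perfPullback_app_toPerfSheaf (p := p) f U.unop s)).trans
      (perfPullbackOver_app_toPerfSheaf (rationalFiberι X) f _ rfl U.unop _)
    have h2 := (congrArg _ (perfPullback_app_toPerfSheaf (p := p) (rationalFiberι Y) U.unop s)).trans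
      (perfPullbackOver_app_toPerfSheaf (rationalFiberMap f) (rationalFiberι Y) _
        (rationalFiberMap_comp_ι f) U.unop _)
    refine h1.trans (Eq.trans (congrArg _ ?_) h2.symm)
    have h3 := congrArg (mulPerfFunctor p).map (hcomm U.unop)
    rw [Functor.map_comp, Functor.map_comp] at h3
    exact congr($h3 s)
  · intro V hV s t hfst hist
    obtain ⟨s, rfl⟩ := (toPerfSheaf_app_bijective hV).2 s
    obtain ⟨t, rfl⟩ := (toPerfSheaf_app_bijective hV).2 t
    rw [perfPullback_app_toPerfSheaf, perfPullback_app_toPerfSheaf] at hfst hist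
    have h1 := toPerfSheaf_app_injective (hV.preimage f).isCompact hfst
    have h2 := toPerfSheaf_app_injective (hV.preimage (rationalFiberι Y)).isCompact hist
    let := (f.app V).hom.toAlgebra
    let := ((rationalFiberι Y).app V).hom.toAlgebra
    have := isLocalization_away_rationalFiberι_app p hV
    exact congrArg _ (MulPerf.eq_of_map_eq_of_map_eq (hf.isNilpotent_of_app_eq_zero hV) h1 h2)
  · intro V hV s t hst
    -- All preimages of `V` are affine: `s` and `t` lift to ring perfections, and their equality
    -- over $X_{\mathbb{Q}}$ can be read there.
    obtain ⟨s, rfl⟩ := (toPerfSheaf_app_bijective (hV.preimage f)).2 s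
    obtain ⟨t, rfl⟩ := (toPerfSheaf_app_bijective (hV.preimage (rationalFiberι Y))).2 t
    have h1 := (perfPullbackOver_app_toPerfSheaf (p := p) _ _ _ rfl V s).symm.trans
      (hst.trans (perfPullbackOver_app_toPerfSheaf (p := p) _ _ _ (rationalFiberMap_comp_ι f) V t))
    have h2 := toPerfSheaf_app_injective
      ((hV.preimage f).preimage (rationalFiberι X)).isCompact h1
    let := (f.app V).hom.toAlgebra
    let := ((rationalFiberι Y).app V).hom.toAlgebra
    let := ((rationalFiberι X).appLE (f ⁻¹ᵁ V) ((rationalFiberι X ≫ f) ⁻¹ᵁ V)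
        (Scheme.Hom.comp_preimage _ _ _).le).hom.toAlgebra
    let := ((rationalFiberMap f).appLE (rationalFiberι Y ⁻¹ᵁ V)
        ((rationalFiberι X ≫ f) ⁻¹ᵁ V) (by rw [← rationalFiberMap_comp_ι, Scheme.Hom.comp_preimage])).hom.toAlgebra
    have := isLocalization_away_rationalFiberι_app p hV
    have : IsLocalization.Away (p : Γ(X, f ⁻¹ᵁ V))
        Γ(rationalFiber X, (rationalFiberι X ≫ f) ⁻¹ᵁ V) := by
      have := isLocalization_away_rationalFiberι_app p (hV.preimage f)
      rw [← Scheme.Hom.appLE_eq_app] at this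
      exact this
    have : Algebra.IsIntegral Γ(Y, V) Γ(X, f ⁻¹ᵁ V) := ⟨f.isIntegral_app V hV⟩
    obtain ⟨z, hz1, hz2⟩ := MulPerf.exists_map_eq_of_map_eq
      (A := Γ(Y, V)) (A' := Γ(rationalFiber Y, rationalFiberι Y ⁻¹ᵁ V)) (B := Γ(X, f ⁻¹ᵁ V))
      (B' := Γ(rationalFiber X, (rationalFiberι X ≫ f) ⁻¹ᵁ V)) (fun a ↦ congr($(hcomm V).hom a))
      (hf.isNilpotent_of_app_eq_zero hV)
      (UniversallyInjective.isNilpotent_tmul_sub f hV (hV.preimage f)) h2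
    exact ⟨(toPerfSheaf p Y).app (Opposite.op V) z,
      (perfPullback_app_toPerfSheaf _ _ _).trans (congrArg _ hz1),
      (perfPullback_app_toPerfSheaf _ _ _).trans (congrArg _ hz2)⟩
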